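/- **The code.** For $n\ge 1$ put $N=3^n$ ququarts ($\mathbb C^4$, basis $|0\rangle,\dots,|3\rangle$) on the level-$n$ Sierpiński lattice. A block of level $0$ is a single qudit. A block of level $k+1$ consists of three blocks of level $k$, numbered $0,1,2$ clockwise (mod $3$), placed around a hole. Every block has three corners: corner $0$ (towards the preceding block), corner $1$ (outward) and corner $2$ (towards the next block). Corner $c$ of a block of level $k+1$ is corner $1$ of its sub-block $c$. Around each hole, corner $2$ of sub-block $a$ is joined to corner $0$ of sub-block $a+1$; this gives all pairs of neighbours. Let $S^1,S^2,S^3$ be the permutation matrices of $(01)(23)$, $(02)(13)$, $(03)(12)$. For a neighbouring pair $(i,i')$ let $T_{ii'}=S^2_iS^3_{i'}$ if the pair lies in one smallest three-qudit block ($i'$ following $i$ clockwise), and $T_{ii'}=S^1_iS^1_{i'}$ otherwise. Let $|\psi_m\rangle$ be the product basis states obtained from $|0\cdots0\rangle$ by products of the gates $T_{ii'}$. Draw a qudit as a triangle with angles at its corners $1,2,0$ labelled $1,2,3$. For $|0\rangle$ no side is dark; for $|\sigma\rangle$, $\sigma=1,2,3$, the two sides meeting at the angle $\sigma$ are dark.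 The loop around a hole has three laterals, formed by the inward-facing sides of the qudits along the inner edges of the three surrounding blocks. To each $|\psi_m\rangle$ and each hole $\boldsymbol x$ assign $\boldsymbol\beta_{\boldsymbol x}\in\{0,1,2,3\}$: it is $0$ if all three laterals have an even number of dark sides, and otherwise it is the label of the unique lateral with an even number (the laterals of sub-blocks $1,2,0$ have the labels $1,2,3$). With one bulk ququart per hole and $K=(3^n-1)/2$ holes, the encoding $R$ is the adjoint of the operator $R^+$ given by $R^+|\psi_m\rangle=2^{-K/2}|\{\boldsymbol\beta_{\boldsymbol x}\}\rangle$ and by $0$ on the other product basis states; $P_{\rm code}=RR^+$. **Connected distance.** In the standard 1D geometry the qudits lie on a ring of $N$ sites: the three sub-blocks of the whole lattice occupy three consecutive segments of length $N/3$ in the order $0,1,2$, and so on recursively inside each block. A subregion is connected if it consists of consecutive sites of the ring. Let $\mathcal M(\boldsymbol x)$ be the set of all $R(O_{\boldsymbol x}\otimes\mathbf 1)R^+$ with $O_{\boldsymbol x}$ an operator on the bulk qudit $\boldsymbol x$. It can be reconstructed on $A$ if each of its elements equals $P_{\rm code}O_AP_{\rm code}$ for some $O_A$ supported on $A$ that commutes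 with $P_{\rm code}$. Let $\mathrm d_c(\boldsymbol x)$ be the least size $|\overline A|$ of a connected subregion $\overline A$ such that $\mathcal M(\boldsymbol x)$ cannot be reconstructed on its complement $A$. **Theorem.** Let $\boldsymbol x$ be a hole of radial generation $r$, $0\le r\le n-1$ ($r=0$ for the central hole, $r=1$ for the central holes of its three sub-blocks, and so on outward). The minimum defining $\mathrm d_c(\boldsymbol x)$ is attained. If $r\le n-2$, then $$\mathrm d_c(\boldsymbol x)=\frac{N}{3^{r+2}}+1,$$ so that the values from the centre outward are $\frac N9+1,\frac N{27}+1,\frac N{81}+1,\dots$; in particular $\mathrm d_c$ is linear in $N$ for fixed $r$. For the smallest holes ($r=n-1$, surrounded by three qudits) $\mathrm d_c(\boldsymbol x)=1$. Moreover $\mathrm d_c$ strictly decreases towards the boundary: if $\boldsymbol y$ has a larger generation than $\boldsymbol x$, then $\mathrm d_c(\boldsymbol y)<\mathrm d_c(\boldsymbol x)$. -/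

import Mathlib

open scoped Matrix

noncomputable section

namespace SierpinskiCode

/-! ### Tensor-product operators

A system of ququarts indexed by a finite type `ι` has the orthonormal product basis
`|α⟩`, `α : ι → Fin 4`; an operator on `(ℂ⁴)^{⊗ ι}` is a matrix in this basis. -/

/-- The operator `⨂ i, O i`. -/
def tensorOp {ι : Type} [Fintype ι] (O : ι → Matrix (Fin 4) (Fin 4) ℂ) :
    Matrix (ι → Fin 4) (ι → Fin 4) ℂ :=
  fun α β => ∏ i, O i (α i) (β i)

/-- The operator acting as `M` on the single qudit `i` and trivially on all the others. -/
def localOp {ι : Type} [Fintype ι] [DecidableEq ι] (i : ι) (M : Matrix (Fin 4) (Fin 4) ℂ) :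
    Matrix (ι → Fin 4) (ι → Fin 4) ℂ :=
  tensorOp (Function.update (fun _ => 1) i M)

/-- `O` is supported on `A`, i.e. it is of the form `O_A ⊗ 1` with respect to the decomposition
of the system into the qudits in `A` and the qudits outside `A`. -/
def SupportedOn {ι : Type} [Fintype ι] [DecidableEq ι] (A : Finset ι)
    (O : Matrix (ι → Fin 4) (ι → Fin 4) ℂ) : Prop :=
  ∃ M : Matrix (A → Fin 4) (A → Fin 4) ℂ, ∀ α β : ι → Fin 4,
    O α β = if ∀ i, i ∉ A → α i = β i then M (fun i => α i) (fun i => β i) else 0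

/-- The single-qudit operators `S⁰ = 1, S¹, S², S³`. -/
def S : Fin 4 → Matrix (Fin 4) (Fin 4) ℂ :=
  ![1,
    !![0, 1, 0, 0; 1, 0, 0, 0; 0, 0, 0, 1; 0, 0, 1, 0],
    !![0, 0, 1, 0; 0, 0, 0, 1; 1, 0, 0, 0; 0, 1, 0, 0],
    !![0, 0, 0, 1; 0, 0, 1, 0; 0, 1, 0, 0; 1, 0, 0, 0]]

/-! ### The Sierpinski arrangement of the physical qudits -/

/-- The sites of the level-`n` Sierpinski lattice. The lattice of level `n + 1` consists of three
blocks of level `n`, numbered `0, 1, 2` clockwise. -/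
def Site : ℕ → Type
  | 0 => Unit
  | n + 1 => Fin 3 × Site n

instance Site.instFintype : ∀ n, Fintype (Site n)
  | 0 => inferInstanceAs (Fintype Unit)
  | n + 1 =>
    letI := Site.instFintype n
    inferInstanceAs (Fintype (Fin 3 × Site n))

instance Site.instDecidableEq : ∀ n, DecidableEq (Site n)
  | 0 => inferInstanceAs (DecidableEq Unit)
  | n + 1 =>
    letI := Site.instDecidableEq n
    inferInstanceAs (DecidableEq (Fin 3 × Site n))

/-- The holes of the level-`n` lattice: the lattice of level `n + 1` has a central hole (`none`)
and the holes of its three blocks. -/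
def Hole : ℕ → Type
  | 0 => Empty
  | n + 1 => Option (Fin 3 × Hole n)

instance Hole.instFintype : ∀ n, Fintype (Hole n)
  | 0 => inferInstanceAs (Fintype Empty)
  | n + 1 =>
    letI := Hole.instFintype n
    inferInstanceAs (Fintype (Option (Fin 3 × Hole n)))

instance Hole.instDecidableEq : ∀ n, DecidableEq (Hole n)
  | 0 => inferInstanceAs (DecidableEq Empty)
  | n + 1 =>
    letI := Hole.instDecidableEq n
    inferInstanceAs (DecidableEq (Option (Fin 3 × Hole n)))

/-- The radial generation of a hole: `0` for the central hole, `1` for the central holes of the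
three largest proper blocks, and so on outward. -/
def depth : ∀ n, Hole n → ℕ
  | 0, x => x.elim
  | _ + 1, none => 0
  | n + 1, some (_, y) => depth n y + 1

/-- A block has three corners, numbered clockwise. Inside a larger block, its corner `1` points
outward, its corner `0` is joined to the preceding block and its corner `2` to the next one
(clockwise). Hence corner `c` of a block is the outward corner of its sub-block `c`. -/
def corner : ∀ n, Fin 3 → Site n
  | 0, _ => ()
  | n + 1, c => (c, corner n 1)

/-- A single qudit is drawn as a triangle whose angles are labelled `1, 2, 3` clockwise, with `1`
pointing out of the smallest three-qudit block. In the numbering of corners used above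
(`1` outward, `2` towards the next qudit, `0` towards the preceding one) the labels are these. -/
def label : Fin 3 → Fin 4 := ![3, 1, 2]

/-- The label of the angle of the qudit at corner `c` of a block with which it touches the
neighbour of that block. -/
def cornerLabel : ℕ → Fin 3 → Fin 4
  | 0, c => label c
  | _ + 1, _ => 1

/-- The two ends, with the superscripts of the operators `S` acting there, of the nearest-neighbour
pair that lies at the junction of the blocks `a` and `a + 1` around the hole `x`.
Each pair of neighbours of the lattice occurs exactly once. -/
def pair : ∀ n, Hole n → Fin 3 → (Site n × Fin 4) × (Site n × Fin 4)
  | 0, x, _ => x.elim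
  | n + 1, none, a =>
    (((a, corner n 2), cornerLabel n 2), ((a + 1, corner n 0), cornerLabel n 0))
  | n + 1, some (b, y), a =>
    (((b, (pair n y a).1.1), (pair n y a).1.2), ((b, (pair n y a).2.1), (pair n y a).2.2))

/-- The two-qudit gate `T_{ii'}`: it is `S¹ S¹` for neighbours in different smallest blocks and
`S² S³` for clockwise neighbours `i, i'` in the same smallest block. -/
def gate (n : ℕ) (x : Hole n) (a : Fin 3) : Matrix (Site n → Fin 4) (Site n → Fin 4) ℂ :=
  localOp (pair n x a).1.1 (S (pair n x a).1.2) * localOp (pair n x a).2.1 (S (pair n x a).2.2)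

/-- `|α⟩` is one of the product states `|ψ_m⟩`: it is obtained from `|0⋯0⟩` by applying finitely
many gates. -/
def IsPsi (n : ℕ) (α : Site n → Fin 4) : Prop :=
  ∃ L : List (Hole n × Fin 3),
    (L.map fun g => gate n g.1 g.2).prod *ᵥ Pi.single (fun _ => 0) 1 = Pi.single α 1

/-! ### Entanglement patterns and the encoding -/

/-- The side opposite to the corner `c` of the triangle representing `|v⟩` is dark. The triangle
of `|0⟩` has no dark side; the one of `|σ⟩` has exactly one light side, opposite to the angle
labelled `σ`. -/
def IsDark (v : Fin 4) (c : Fin 3) : Prop := v ≠ 0 ∧ v ≠ label c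

instance (v : Fin 4) (c : Fin 3) : Decidable (IsDark v c) := inferInstanceAs (Decidable (_ ∧ _))

/-- The number of dark sides along the lateral opposite to the corner `c` of a block. This lateral
consists of the lateral opposite to the corner `0` of the sub-block `c + 1` and of the lateral
opposite to the corner `2` of the sub-block `c + 2`. -/
def lateralDark : ∀ n, Fin 3 → (Site n → Fin 4) → ℕ
  | 0, c, α => if IsDark (α ()) c then 1 else 0
  | n + 1, c, α =>
    lateralDark n 0 (fun w => α (c + 1, w)) + lateralDark n 2 (fun w => α (c + 2, w))

/-- The number of dark sides on the `a`-th lateral of the loop around the hole `x`, which is the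
inward lateral (opposite to the outward corner) of the block `a` around `x`. -/
def loopDark : ∀ n, Hole n → Fin 3 → (Site n → Fin 4) → ℕ
  | 0, x, _, _ => x.elim
  | n + 1, none, a, α => lateralDark n 1 (fun w => α (a, w))
  | n + 1, some (b, y), a, α => loopDark n y a (fun w => α (b, w))

/-- The emergent degree of freedom at the hole `x` of a state `|ψ_m⟩ = |α⟩`: it is `0` if all three
laterals of the loop carry an even number of dark sides; otherwise exactly one of them does, and
its label is the value. -/
def pattern (n : ℕ) (α : Site n → Fin 4) (x : Hole n) : Fin 4 :=
  if ∀ a, Even (loopDark n x a α) then 0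
  else if Even (loopDark n x 0 α) then label 0
  else if Even (loopDark n x 1 α) then label 1
  else label 2

open scoped Classical in
/-- `R⁺`, which sends `|ψ_m⟩` to `2^{-K/2} |β⟩`, with `β` the pattern of `ψ_m` and `K` the number
of bulk qudits, and which vanishes on the other product states. -/
def encodingAdj (n : ℕ) : Matrix (Hole n → Fin 4) (Site n → Fin 4) ℂ :=
  fun b α => if IsPsi n α ∧ pattern n α = b then
    (((Real.sqrt (2 ^ Fintype.card (Hole n)))⁻¹ : ℝ) : ℂ) else 0

/-- The encoding `R`. -/
def encoding (n : ℕ) : Matrix (Site n → Fin 4) (Hole n → Fin 4) ℂ := (encodingAdj n)ᴴ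

/-- The projection `R R⁺` onto the code subspace. -/
def codeProj (n : ℕ) : Matrix (Site n → Fin 4) (Site n → Fin 4) ℂ :=
  encoding n * (encoding n)ᴴ

/-- The algebra `ℳ(x)` of logical operators of the single bulk qudit `x`. -/
def bulkAlgebra (n : ℕ) (x : Hole n) : Set (Matrix (Site n → Fin 4) (Site n → Fin 4) ℂ) :=
  {O | ∃ M : Matrix (Fin 4) (Fin 4) ℂ, O = encoding n * localOp x M * (encoding n)ᴴ}

/-- The logical operator `L` can be reconstructed on the set `A` of physical qudits. -/
def ReconstructibleOn (n : ℕ) (A : Finset (Site n))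
    (L : Matrix (Site n → Fin 4) (Site n → Fin 4) ℂ) : Prop :=
  ∃ O, SupportedOn A O ∧ Commute O (codeProj n) ∧ L = codeProj n * O * codeProj n

/-! ### The standard one-dimensional geometry -/

/-- The position, in `{0, …, 3ⁿ - 1}`, of a qudit on the boundary ring: the three blocks of the
lattice become three consecutive segments, and so on recursively. -/
def position : ∀ n, Site n → ℕ
  | 0, _ => 0
  | n + 1, (a, w) => a.val * 3 ^ n + position n w

/-- `B` is a connected boundary subregion: a set of consecutive sites of the ring of `3ⁿ` sites. -/
def IsArc (n : ℕ) (B : Finset (Site n)) : Prop :=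
  ∃ s l : ℕ, ∀ i, i ∈ B ↔ ∃ k < l, position n i ≡ s + k [MOD 3 ^ n]

/-- The sizes of the connected boundary subregions `B` such that `ℳ(x)` cannot be reconstructed
on the complement of `B`. -/
def uncorrectableSizes (n : ℕ) (x : Hole n) : Set ℕ :=
  {k | ∃ B : Finset (Site n), IsArc n B ∧ B.card = k ∧
    ¬ ∀ L ∈ bulkAlgebra n x, ReconstructibleOn n Bᶜ L}

/-- The connected code distance `d_c(x)`. -/
def connectedDistance (n : ℕ) (x : Hole n) : ℕ := sInf (uncorrectableSizes n x)

end SierpinskiCode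

end

/-!
Identify the values of a ququart with the Klein four-group `(ℤ/2)²` (bitwise exclusive or of
`0, 1, 2, 3`). A gate adds a fixed configuration, its *excitation*, so the states `ψ_m` form the
subgroup spanned by the excitations, and a product of gates is a function `t` from junctions to
`ℤ/2`. The side of a qudit opposite to the corner `c` is dark if and only if `t` differs at the two
other corners. The parity of dark sides along a path of sides is therefore the difference of `t` at
the ends of the path, whatever path is chosen, and the pattern at a hole `x` is the triple of the
values of `t` at the three junctions around `x`, modulo `(1, 1, 1)`.

Hence the gates at `x` act on the code as the shifts of the bulk qudit `x` (`isShift_excitation`,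
`implements_gate`), any two of them generating all shifts, and the parity of each of the three
blocks around `x` reads off one bit of it, any two of the blocks giving all of it; this parity can
be taken along the lateral of the loop or along any other crossing of the block (`IsCrossing`,
`loopBit_eq_of_isPsi`). All patterns are taken equally often, so `R⁺ R` is a nonzero multiple of
the identity (`exists_conjTranspose_mul_encoding`). If the value of `x` can be read off and shifted
on `A`, its whole algebra is reconstructed there (`reconstructibleOn_of_shifts`); if an operator on
`B` implements a logical operator which fails to commute with one of `x`, that one cannot be
reconstructed on the complement of `B` (`Implements.not_reconstructibleOn`).

Let the blocks around `x` have level `k + 1`. The two ends of the gate at a junction are `3 ^ k`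
sites apart on the ring, so that a segment of `3 ^ k + 1` sites contains a shift. Conversely, take
in each block the *detour* through its outward sub-block. It runs between the sites at which the block
is joined to its two neighbours (`detourBit_congr`), so the detours of different blocks are at
least `3 ^ k` sites apart, as are the six ends of the gates. An arc of at most `3 ^ k` sites thus
spares two detours and two gates, and `x` is reconstructed on its complement
(`reconstructibleOn_compl_of_card_le`). Around the smallest holes each lateral is a side of a single
qudit, which already reads off one bit.
-/

open scoped Matrix

noncomputable section

namespace SierpinskiCode

/-! ### Configurations and excitations -/

/-- The pointwise sum of two configurations, where the values `0, 1, 2, 3` of a ququart are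
identified with the Klein four-group (bitwise exclusive or). -/
def xadd {ι : Type} (α β : ι → Fin 4) : ι → Fin 4 := fun i => α i ^^^ β i

local infixl:65 " ∔ " => xadd

theorem fin4_xor_self : ∀ u : Fin 4, u ^^^ u = 0 := by decide

theorem fin4_xor_zero : ∀ u : Fin 4, u ^^^ 0 = u := by decide

theorem fin4_zero_xor : ∀ u : Fin 4, 0 ^^^ u = u := by decide

theorem fin4_xor_comm : ∀ u v : Fin 4, u ^^^ v = v ^^^ u := by decide

theorem fin4_xor_assoc : ∀ u v w : Fin 4, (u ^^^ v) ^^^ w = u ^^^ (v ^^^ w) := by decide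

theorem xadd_assoc {ι : Type} (α β γ : ι → Fin 4) : α ∔ β ∔ γ = α ∔ (β ∔ γ) :=
  funext fun i => fin4_xor_assoc (α i) (β i) (γ i)

theorem xadd_comm {ι : Type} (α β : ι → Fin 4) : α ∔ β = β ∔ α :=
  funext fun i => fin4_xor_comm (α i) (β i)

theorem xadd_zero {ι : Type} (α : ι → Fin 4) : α ∔ (fun _ => 0) = α :=
  funext fun i => fin4_xor_zero (α i)

theorem xadd_self {ι : Type} (α : ι → Fin 4) : α ∔ α = fun _ => 0 :=
  funext fun i => fin4_xor_self (α i)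

theorem xadd_xadd_cancel {ι : Type} (α β : ι → Fin 4) : α ∔ β ∔ β = α := by
  rw [xadd_assoc, xadd_self, xadd_zero]

theorem eq_xadd_iff {ι : Type} {α β γ : ι → Fin 4} : α = β ∔ γ ↔ β = α ∔ γ := by
  constructor <;> rintro rfl <;> rw [xadd_xadd_cancel]

/-- The configuration with value `v` at `i` and `0` elsewhere. -/
def point {ι : Type} [DecidableEq ι] (i : ι) (v : Fin 4) : ι → Fin 4 :=
  fun j => if j = i then v else 0

/-- The configuration which the gate `(x, a)` adds to every configuration. -/
def excitation (n : ℕ) (x : Hole n) (a : Fin 3) : Site n → Fin 4 :=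
  point (pair n x a).1.1 (pair n x a).1.2 ∔ point (pair n x a).2.1 (pair n x a).2.2

/-- The restriction to a block of the excitation of a gate at its corner `c`. -/
def cornerExc (n : ℕ) (c : Fin 3) : Site n → Fin 4 := point (corner n c) (cornerLabel n c)

/-- The restriction of a configuration to the sub-block `b`. -/
def restrict {n : ℕ} (b : Fin 3) (α : Site (n + 1) → Fin 4) : Site n → Fin 4 :=
  fun w => α (b, w)

theorem restrict_xadd {n : ℕ} (b : Fin 3) (α β : Site (n + 1) → Fin 4) :
    restrict b (α ∔ β) = restrict b α ∔ restrict b β := rfl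

theorem restrict_point {n : ℕ} (b a : Fin 3) (w : Site n) (v : Fin 4) :
    restrict b (point (ι := Site (n + 1)) (a, w) v) = if b = a then point w v else fun _ => 0 := by
  funext u
  have h : ((b, u) : Fin 3 × Site n) = (a, w) ↔ b = a ∧ u = w := Prod.mk.injEq _ _ _ _ ▸ Iff.rfl
  have h' : (@Eq (Site (n + 1)) (b, u) (a, w)) ↔ b = a ∧ u = w := h
  rw [apply_ite (fun f : Site n → Fin 4 => f u)]
  simp only [restrict, point, h', ite_and]

theorem cornerLabel_one : ∀ n, cornerLabel n 1 = 1
  | 0 => rfl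
  | _ + 1 => rfl

theorem restrict_cornerExc {n : ℕ} (b c : Fin 3) :
    restrict b (cornerExc (n + 1) c) = if b = c then cornerExc n 1 else fun _ => 0 := by
  have := restrict_point b c (corner n 1) (cornerLabel n 1)
  nth_rw 1 [cornerLabel_one] at this
  exact this

theorem restrict_excitation_none {n : ℕ} (a b : Fin 3) :
    restrict b (excitation (n + 1) none a) =
      if b = a then cornerExc n 2 else if b = a + 1 then cornerExc n 0 else fun _ => 0 := by
  have h : restrict b (excitation (n + 1) none a) =
      (if b = a then cornerExc n 2 else fun _ => 0) ∔
        (if b = a + 1 then cornerExc n 0 else fun _ => 0) := by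
    rw [cornerExc, cornerExc, ← restrict_point, ← restrict_point]
    rfl
  rw [h]
  have hne : ∀ a : Fin 3, a ≠ a + 1 := by decide
  by_cases h1 : b = a
  · subst h1; simp only [if_true, hne b, if_false, xadd_zero]
  · simp only [h1, if_false]
    rw [xadd_comm, xadd_zero]

theorem restrict_excitation_some {n : ℕ} (a b b' : Fin 3) (y : Hole n) :
    restrict b (excitation (n + 1) (some (b', y)) a) =
      if b = b' then excitation n y a else fun _ => 0 := by
  have h : restrict b (excitation (n + 1) (some (b', y)) a) =
      (if b = b' then point (pair n y a).1.1 (pair n y a).1.2 else fun _ => 0) ∔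
        (if b = b' then point (pair n y a).2.1 (pair n y a).2.2 else fun _ => 0) := by
    rw [← restrict_point, ← restrict_point]
    rfl
  rw [h]
  by_cases h1 : b = b'
  · simp only [h1, if_true]; rfl
  · simp only [h1, if_false]; rfl

/-! ### Parities of dark sides -/

/-- The parity of the number of dark sides opposite to the corner `c` of a single triangle. -/
def darkBit (v : Fin 4) (c : Fin 3) : ZMod 2 := if IsDark v c then 1 else 0

theorem darkBit_xor : ∀ u v c, darkBit (u ^^^ v) c = darkBit u c + darkBit v c := by
  unfold darkBit; decide

theorem darkBit_label : ∀ c' c, darkBit (label c') c = if c = c' then 0 else 1 := by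
  unfold darkBit; decide

/-- The parity of the number of dark sides along the lateral of a block opposite to its corner
`c`. -/
def lateralBit (n : ℕ) (c : Fin 3) (α : Site n → Fin 4) : ZMod 2 := (lateralDark n c α : ZMod 2)

theorem lateralBit_zero (c : Fin 3) (α : Site 0 → Fin 4) :
    lateralBit 0 c α = darkBit (α ()) c := by
  simp [lateralBit, lateralDark, darkBit]

theorem lateralBit_succ (n : ℕ) (c : Fin 3) (α : Site (n + 1) → Fin 4) :
    lateralBit (n + 1) c α =
      lateralBit n 0 (restrict (c + 1) α) + lateralBit n 2 (restrict (c + 2) α) := by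
  simp only [lateralBit, lateralDark, Nat.cast_add]
  rfl

theorem lateralBit_xadd : ∀ (n : ℕ) (c : Fin 3) (α β : Site n → Fin 4),
    lateralBit n c (α ∔ β) = lateralBit n c α + lateralBit n c β
  | 0, c, α, β => by simp only [lateralBit_zero, xadd, darkBit_xor]
  | n + 1, c, α, β => by
    simp only [lateralBit_succ, restrict_xadd, lateralBit_xadd n]
    ring

theorem map_zero_of_map_xadd {ι : Type} {φ : (ι → Fin 4) → ZMod 2}
    (h : ∀ α β, φ (α ∔ β) = φ α + φ β) : φ (fun _ => 0) = 0 := by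
  have := h (fun _ => 0) (fun _ => 0)
  rw [xadd_self] at this
  simpa using this

theorem lateralBit_zero_config (n : ℕ) (c : Fin 3) : lateralBit n c (fun _ => 0) = 0 :=
  map_zero_of_map_xadd (lateralBit_xadd n c)

/-- A lateral is a path between two corners of its block, so that its parity detects exactly the
excitations of these corners. -/
theorem lateralBit_cornerExc : ∀ (n : ℕ) (c c' : Fin 3),
    lateralBit n c (cornerExc n c') = if c = c' then 0 else 1
  | 0, c, c' => by
    have : cornerExc 0 c' () = label c' := rfl
    rw [lateralBit_zero, this, darkBit_label]
  | n + 1, c, c' => by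
    rw [lateralBit_succ, restrict_cornerExc, restrict_cornerExc]
    simp only [apply_ite (lateralBit n _), lateralBit_cornerExc n, lateralBit_zero_config]
    revert c c'; decide

/-- Every gate touches a lateral at an even number of sides. -/
theorem lateralBit_excitation : ∀ (n : ℕ) (c : Fin 3) (x : Hole n) (a : Fin 3),
    lateralBit n c (excitation n x a) = 0
  | 0, _, x, _ => x.elim
  | n + 1, c, none, a => by
    simp only [lateralBit_succ, restrict_excitation_none, apply_ite (lateralBit n _),
      lateralBit_cornerExc, lateralBit_zero_config]
    revert c a; decide
  | n + 1, c, some (b, y), a => by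
    simp only [lateralBit_succ, restrict_excitation_some, apply_ite (lateralBit n _),
      lateralBit_excitation n, lateralBit_zero_config, ite_self, add_zero]

/-- A family `φ` of parities, one for each level, which behave like the parity of dark sides along
a path from the corner `0` to the corner `2` of a block: additive, changed by the gates at these two
corners only. -/
structure IsCrossing (φ : ∀ n, (Site n → Fin 4) → ZMod 2) : Prop where
  map_xadd : ∀ n α β, φ n (α ∔ β) = φ n α + φ n β
  map_cornerExc : ∀ n c, φ n (cornerExc n c) = if c = 1 then 0 else 1
  map_excitation : ∀ n x a, φ n (excitation n x a) = 0

theorem isCrossing_lateralBit : IsCrossing fun n => lateralBit n 1 where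
  map_xadd n := lateralBit_xadd n 1
  map_cornerExc n c := by
    rw [lateralBit_cornerExc]; revert c; decide
  map_excitation n x a := lateralBit_excitation n 1 x a

/-- The parity of the path from the corner `0` to the corner `2` of a block which, unlike the
inward lateral, passes through the outward sub-block `1`. -/
def detourBit : ∀ n, (Site n → Fin 4) → ZMod 2
  | 0, α => lateralBit 0 1 α
  | n + 1, α => lateralBit n 0 (restrict 0 α) + lateralBit n 1 (restrict 1 α) +
      lateralBit n 2 (restrict 2 α)

theorem isCrossing_detourBit : IsCrossing detourBit where
  map_xadd
    | 0, α, β => lateralBit_xadd 0 1 α β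
    | n + 1, α, β => by
      simp only [detourBit, restrict_xadd, lateralBit_xadd]; ring
  map_cornerExc
    | 0, c => isCrossing_lateralBit.map_cornerExc 0 c
    | n + 1, c => by
      simp only [detourBit, restrict_cornerExc, apply_ite (lateralBit n _), lateralBit_cornerExc,
        lateralBit_zero_config]
      revert c; decide
  map_excitation
    | 0, x, _ => x.elim
    | n + 1, none, a => by
      simp only [detourBit, restrict_excitation_none, apply_ite (lateralBit n _),
        lateralBit_cornerExc, lateralBit_zero_config]
      revert a; decide
    | n + 1, some (b, y), a => by
      simp only [detourBit, restrict_excitation_some, apply_ite (lateralBit n _),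
        lateralBit_excitation, lateralBit_zero_config, ite_self, add_zero]

/-- The parity `φ` of the block `a` around the hole `x`. -/
def loopBit (φ : ∀ n, (Site n → Fin 4) → ZMod 2) :
    ∀ n, Hole n → Fin 3 → (Site n → Fin 4) → ZMod 2
  | 0, x, _, _ => x.elim
  | n + 1, none, a, α => φ n (restrict a α)
  | n + 1, some (b, y), a, α => loopBit φ n y a (restrict b α)

theorem loopBit_lateralBit : ∀ (n : ℕ) (x : Hole n) (a : Fin 3) (α : Site n → Fin 4),
    loopBit (fun n => lateralBit n 1) n x a α = (loopDark n x a α : ZMod 2)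
  | 0, x, _, _ => x.elim
  | _ + 1, none, _, _ => rfl
  | n + 1, some (b, y), a, α => loopBit_lateralBit n y a (restrict b α)

namespace IsCrossing

variable {φ : ∀ n, (Site n → Fin 4) → ZMod 2}

theorem map_zero (h : IsCrossing φ) (n : ℕ) : φ n (fun _ => 0) = 0 :=
  map_zero_of_map_xadd (h.map_xadd n)

theorem loopBit_xadd (h : IsCrossing φ) : ∀ (n : ℕ) (x : Hole n) (a : Fin 3)
    (α β : Site n → Fin 4), loopBit φ n x a (α ∔ β) = loopBit φ n x a α + loopBit φ n x a β
  | 0, x, _, _, _ => x.elim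
  | n + 1, none, a, α, β => h.map_xadd n (restrict a α) (restrict a β)
  | n + 1, some (b, y), a, α, β => loopBit_xadd h n y a (restrict b α) (restrict b β)

theorem loopBit_zero (h : IsCrossing φ) (n : ℕ) (x : Hole n) (a : Fin 3) :
    loopBit φ n x a (fun _ => 0) = 0 :=
  map_zero_of_map_xadd (h.loopBit_xadd n x a)

theorem loopBit_cornerExc (h : IsCrossing φ) : ∀ (n : ℕ) (x : Hole n) (a c : Fin 3),
    loopBit φ n x a (cornerExc n c) = 0
  | 0, x, _, _ => x.elim
  | n + 1, none, a, c => by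
    simp only [loopBit, restrict_cornerExc, apply_ite (φ n), h.map_cornerExc, h.map_zero,
      if_true, ite_self]
  | n + 1, some (b, y), a, c => by
    simp only [loopBit, restrict_cornerExc, apply_ite (loopBit φ n y a), loopBit_cornerExc h n,
      h.loopBit_zero, ite_self]

/-- The gate `(x, b)` acts at the junction of the blocks `b` and `b + 1` around `x`, and hence
changes the parities of exactly these two blocks, and none around other holes. -/
theorem loopBit_excitation (h : IsCrossing φ) : ∀ (n : ℕ) (y x : Hole n) (a b : Fin 3),
    loopBit φ n y a (excitation n x b) = if y = x ∧ a ≠ b + 2 then 1 else 0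
  | 0, x, _, _, _ => x.elim
  | n + 1, none, none, a, b => by
    have this (p : Prop) : (@Eq (Hole (n + 1)) none none ∧ p) ↔ p :=
      ⟨And.right, fun hp => ⟨rfl, hp⟩⟩
    simp only [loopBit, restrict_excitation_none, apply_ite (φ n), h.map_cornerExc, h.map_zero,
      this]
    clear h this
    revert a b; decide
  | n + 1, none, some (c, x), a, b => by
    have : ¬ (@Eq (Hole (n + 1)) none (some (c, x))) := nofun
    simp only [loopBit, restrict_excitation_some, apply_ite (φ n), h.map_excitation, h.map_zero,
      ite_self, this, false_and, if_false]
  | n + 1, some (c, y), none, a, b => by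
    have : ¬ (@Eq (Hole (n + 1)) (some (c, y)) none) := nofun
    simp only [loopBit, restrict_excitation_none, apply_ite (loopBit φ n y a),
      h.loopBit_cornerExc, h.loopBit_zero, ite_self, this, false_and, if_false]
  | n + 1, some (c, y), some (d, x), a, b => by
    have : (@Eq (Hole (n + 1)) (some (c, y)) (some (d, x))) ↔ c = d ∧ y = x := by
      constructor
      · intro e
        have e' : (c, y) = (d, x) := Option.some.inj e
        exact Prod.mk.inj e'
      · rintro ⟨rfl, rfl⟩; rfl
    simp only [loopBit, restrict_excitation_some, apply_ite (loopBit φ n y a),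
      loopBit_excitation h n, h.loopBit_zero, this]
    by_cases hc : c = d <;> simp [hc]

end IsCrossing

/-! ### Gates and the states `ψ_m` -/

theorem localOp_apply {ι : Type} [Fintype ι] [DecidableEq ι] (i : ι)
    (M : Matrix (Fin 4) (Fin 4) ℂ) (α β : ι → Fin 4) :
    localOp i M α β = if ∀ j, j ≠ i → α j = β j then M (α i) (β i) else 0 := by
  have h : localOp i M α β = M (α i) (β i) *
      ∏ j ∈ Finset.univ.erase i, (1 : Matrix (Fin 4) (Fin 4) ℂ) (α j) (β j) := by
    rw [localOp, tensorOp, ← Finset.mul_prod_erase _ _ (Finset.mem_univ i),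
      Function.update_self]
    congr 1
    refine Finset.prod_congr rfl fun j hj => ?_
    rw [Function.update_of_ne (Finset.ne_of_mem_erase hj)]
  rw [h]
  split_ifs with hc
  · rw [Finset.prod_eq_one, mul_one]
    intro j hj
    rw [hc j (Finset.ne_of_mem_erase hj), Matrix.one_apply_eq]
  · push Not at hc
    obtain ⟨j, hj, hne⟩ := hc
    rw [Finset.prod_eq_zero (i := j) (Finset.mem_erase.2 ⟨hj, Finset.mem_univ j⟩), mul_zero]
    exact Matrix.one_apply_ne hne

theorem S_apply (k u v : Fin 4) : S k u v = if u = v ^^^ k then 1 else 0 := by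
  fin_cases k <;> fin_cases u <;> fin_cases v <;> rfl

theorem localOp_S_apply {ι : Type} [Fintype ι] [DecidableEq ι] (i : ι) (k : Fin 4)
    (α β : ι → Fin 4) : localOp i (S k) α β = if α = β ∔ point i k then 1 else 0 := by
  rw [localOp_apply, S_apply, ← ite_and]
  congr 1
  rw [eq_iff_iff, funext_iff]
  constructor
  · rintro ⟨h1, h2⟩ j
    by_cases hj : j = i
    · subst hj; simpa [xadd, point] using h2
    · simpa [xadd, point, hj, fin4_xor_zero] using h1 j hj
  · intro h
    refine ⟨fun j hj => ?_, ?_⟩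
    · simpa [xadd, point, hj, fin4_xor_zero] using h j
    · simpa [xadd, point] using h i

theorem gate_apply (n : ℕ) (x : Hole n) (a : Fin 3) (α β : Site n → Fin 4) :
    gate n x a α β = if α = β ∔ excitation n x a then 1 else 0 := by
  rw [gate, Matrix.mul_apply,
    Finset.sum_eq_single (β ∔ point (pair n x a).2.1 (pair n x a).2.2)]
  · rw [localOp_S_apply, localOp_S_apply, if_pos rfl, mul_one, excitation, xadd_assoc,
      xadd_comm (point (pair n x a).2.1 (pair n x a).2.2)]
  · intro γ _ hγ
    rw [localOp_S_apply (pair n x a).2.1, if_neg hγ, mul_zero]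
  · exact fun h => absurd (Finset.mem_univ _) h

theorem gate_mulVec_single (n : ℕ) (x : Hole n) (a : Fin 3) (β : Site n → Fin 4) :
    gate n x a *ᵥ Pi.single β 1 = Pi.single (β ∔ excitation n x a) 1 := by
  funext α
  rw [Matrix.mulVec_single_one, Matrix.col_apply, gate_apply, Pi.single_apply]

theorem isPsi_zero (n : ℕ) : IsPsi n fun _ => 0 := ⟨[], Matrix.one_mulVec _⟩

theorem IsPsi.xadd_excitation {n : ℕ} {α : Site n → Fin 4} (h : IsPsi n α) (x : Hole n)
    (a : Fin 3) : IsPsi n (α ∔ excitation n x a) := by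
  obtain ⟨L, hL⟩ := h
  refine ⟨(x, a) :: L, ?_⟩
  rw [List.map_cons, List.prod_cons, ← Matrix.mulVec_mulVec, hL, gate_mulVec_single]

theorem IsPsi.induction {n : ℕ} {p : (Site n → Fin 4) → Prop} (zero : p fun _ => 0)
    (step : ∀ α x a, p α → p (α ∔ excitation n x a)) {α : Site n → Fin 4} (h : IsPsi n α) :
    p α := by
  have key (L : List (Hole n × Fin 3)) : ∃ β, p β ∧
      (L.map fun g => gate n g.1 g.2).prod *ᵥ Pi.single (fun _ => 0) 1 = Pi.single β 1 := by
    induction L with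
    | nil => exact ⟨_, zero, Matrix.one_mulVec _⟩
    | cons g L ih =>
      obtain ⟨β, hβ, e⟩ := ih
      refine ⟨_, step β g.1 g.2 hβ, ?_⟩
      rw [List.map_cons, List.prod_cons, ← Matrix.mulVec_mulVec, e, gate_mulVec_single]
  obtain ⟨L, hL⟩ := h
  obtain ⟨β, hβ, e⟩ := key L
  have : α = β := by
    by_contra hne
    have := congrFun (hL.symm.trans e) α
    rw [Pi.single_eq_same, Pi.single_eq_of_ne hne] at this
    exact one_ne_zero this
  exact this ▸ hβ

/-- On the states `ψ_m`, a parity of a block around a hole does not depend on the path along which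
it is taken. -/
theorem loopBit_eq_of_isPsi {φ φ' : ∀ n, (Site n → Fin 4) → ZMod 2} (h : IsCrossing φ)
    (h' : IsCrossing φ') {n : ℕ} {α : Site n → Fin 4} (hα : IsPsi n α) (x : Hole n) (a : Fin 3) :
    loopBit φ n x a α = loopBit φ' n x a α := by
  refine IsPsi.induction (p := fun α => loopBit φ n x a α = loopBit φ' n x a α) ?_ ?_ hα
  · rw [h.loopBit_zero, h'.loopBit_zero]
  · intro α y b ih
    rw [h.loopBit_xadd, h'.loopBit_xadd, ih, h.loopBit_excitation, h'.loopBit_excitation]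

theorem loopBit_sum_eq_zero {φ : ∀ n, (Site n → Fin 4) → ZMod 2} (h : IsCrossing φ)
    {n : ℕ} {α : Site n → Fin 4} (hα : IsPsi n α) (x : Hole n) :
    ∑ a, loopBit φ n x a α = 0 := by
  refine IsPsi.induction (p := fun α => ∑ a, loopBit φ n x a α = 0) ?_ ?_ hα
  · simp [h.loopBit_zero]
  · intro α y b ih
    simp only [h.loopBit_xadd, h.loopBit_excitation, Finset.sum_add_distrib, ih, zero_add]
    by_cases hx : x = y
    · simp only [hx, true_and]; clear ih; revert b; decide
    · simp [hx]

/-- The value of a ququart of which the three sides have the given parities; meaningful only if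
these add up to `0`. -/
def ofBits (h : Fin 3 → ZMod 2) : Fin 4 :=
  if ∀ a, h a = 0 then 0 else if h 0 = 0 then label 0 else if h 1 = 0 then label 1 else label 2

theorem ofBits_eq_iff (h : Fin 3 → ZMod 2) (hs : ∑ a, h a = 0) (v : Fin 4) :
    ofBits h = v ↔ ∀ a, h a = darkBit v a := by
  revert h v; unfold ofBits darkBit; decide

theorem pattern_eq_ofBits (n : ℕ) (α : Site n → Fin 4) (x : Hole n) :
    pattern n α x = ofBits fun a => loopBit (fun n => lateralBit n 1) n x a α := by
  simp only [pattern, ofBits, loopBit_lateralBit, ZMod.natCast_eq_zero_iff_even]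

/-- The emergent degree of freedom `v` at a hole is the triangle of which the side opposite to
each corner `a` has the parity of the block `a`. -/
theorem pattern_eq_iff {φ : ∀ n, (Site n → Fin 4) → ZMod 2} (h : IsCrossing φ)
    {n : ℕ} {α : Site n → Fin 4} (hα : IsPsi n α) (x : Hole n) (v : Fin 4) :
    pattern n α x = v ↔ ∀ a, loopBit φ n x a α = darkBit v a := by
  rw [pattern_eq_ofBits, ofBits_eq_iff _ (loopBit_sum_eq_zero isCrossing_lateralBit hα x)]
  simp only [loopBit_eq_of_isPsi h isCrossing_lateralBit hα]

theorem loopBit_eq_darkBit_pattern {φ : ∀ n, (Site n → Fin 4) → ZMod 2} (h : IsCrossing φ)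
    {n : ℕ} {α : Site n → Fin 4} (hα : IsPsi n α) (x : Hole n) (a : Fin 3) :
    loopBit φ n x a α = darkBit (pattern n α x) a :=
  (pattern_eq_iff h hα x _).1 rfl a

/-- `τ` is a shift of configurations which preserves the set of the states `ψ_m` and adds `w` to
their pattern. -/
def IsShift (n : ℕ) (τ : Site n → Fin 4) (w : Hole n → Fin 4) : Prop :=
  ∀ α, IsPsi n α → IsPsi n (α ∔ τ) ∧ pattern n (α ∔ τ) = pattern n α ∔ w

theorem isShift_zero (n : ℕ) : IsShift n (fun _ => 0) fun _ => 0 := fun α hα => by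
  rw [xadd_zero, xadd_zero]; exact ⟨hα, rfl⟩

theorem IsShift.xadd {n : ℕ} {τ τ' : Site n → Fin 4} {w w' : Hole n → Fin 4}
    (h : IsShift n τ w) (h' : IsShift n τ' w') : IsShift n (τ ∔ τ') (w ∔ w') := fun α hα => by
  obtain ⟨h1, h2⟩ := h α hα
  obtain ⟨h3, h4⟩ := h' _ h1
  rw [← xadd_assoc, ← xadd_assoc, h4, h2]
  exact ⟨h3, rfl⟩

theorem isShift_excitation (n : ℕ) (x : Hole n) (b : Fin 3) :
    IsShift n (excitation n x b) (point x (label (b + 2))) := fun α hα => by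
  have h := isCrossing_lateralBit
  refine ⟨hα.xadd_excitation x b, funext fun y => ?_⟩
  rw [pattern_eq_iff h (hα.xadd_excitation x b)]
  intro a
  rw [h.loopBit_xadd, h.loopBit_excitation, loopBit_eq_darkBit_pattern h hα]
  by_cases hy : y = x
  · simp only [xadd, point, hy, darkBit_xor, darkBit_label, true_and, if_true, ite_not]
  · simp only [xadd, point, hy, false_and, if_false, fin4_xor_zero, add_zero]

theorem exists_isShift_point (n : ℕ) (x : Hole n) (v : Fin 4) :
    ∃ τ, IsShift n τ (point x v) := by
  have hv : v = 0 ∨ ∃ b : Fin 3, v = label (b + 2) := by revert v; decide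
  rcases hv with rfl | ⟨b, rfl⟩
  · refine ⟨fun _ => 0, ?_⟩
    convert isShift_zero n using 1
    funext y; simp [point]
  · exact ⟨_, isShift_excitation n x b⟩

theorem exists_isShift (n : ℕ) (w : Hole n → Fin 4) : ∃ τ, IsShift n τ w := by
  have key (s : Finset (Hole n)) : ∃ τ, IsShift n τ fun y => if y ∈ s then w y else 0 := by
    induction s using Finset.induction_on with
    | empty => exact ⟨_, isShift_zero n⟩
    | insert x s hx ih =>
      obtain ⟨τ, hτ⟩ := ih
      obtain ⟨σ, hσ⟩ := exists_isShift_point n x (w x)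
      refine ⟨τ ∔ σ, ?_⟩
      convert hτ.xadd hσ using 1
      funext y
      by_cases hy : y = x
      · subst hy; simp [xadd, point, hx, fin4_zero_xor]
      · simp [xadd, point, hy]
  simpa using key Finset.univ

/-! ### The encoding and the implementation of logical operators -/

open scoped Classical in
theorem encoding_apply (n : ℕ) (α : Site n → Fin 4) (b : Hole n → Fin 4) :
    encoding n α b = if IsPsi n α ∧ pattern n α = b then
      (((Real.sqrt (2 ^ Fintype.card (Hole n)))⁻¹ : ℝ) : ℂ) else 0 := by
  rw [encoding, Matrix.conjTranspose_apply, encodingAdj]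
  split_ifs
  · exact Complex.conj_ofReal _
  · exact star_zero _

/-- All patterns are taken by equally many states `ψ_m`, so that the encoding is a multiple of an
isometry. -/
theorem exists_conjTranspose_mul_encoding (n : ℕ) :
    ∃ c : ℂ, c ≠ 0 ∧ (encoding n)ᴴ * encoding n = c • 1 := by
  classical
  set s : ℝ := (Real.sqrt (2 ^ Fintype.card (Hole n)))⁻¹ with hs
  have hs0 : s ≠ 0 := by positivity
  let F (b : Hole n → Fin 4) : Finset (Site n → Fin 4) :=
    Finset.univ.filter fun α => IsPsi n α ∧ pattern n α = b
  have hF (b b' : Hole n → Fin 4) : (F b).card ≤ (F b').card := by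
    obtain ⟨τ, hτ⟩ := exists_isShift n (b ∔ b')
    refine Finset.card_le_card_of_injOn (· ∔ τ) (fun α hα' => ?_) fun α _ β _ e => ?_
    · obtain ⟨hα, rfl⟩ := (Finset.mem_filter.1 (Finset.mem_coe.1 hα')).2
      refine Finset.mem_coe.2 (Finset.mem_filter.2 ⟨Finset.mem_univ _, (hτ α hα).1, ?_⟩)
      rw [(hτ α hα).2, xadd_comm, xadd_comm (pattern n α), xadd_xadd_cancel]
    · have := congrArg (· ∔ τ) e
      simpa only [xadd_xadd_cancel] using this
  let b₀ := pattern n fun _ => 0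
  have h0 : 0 < (F b₀).card :=
    Finset.card_pos.2 ⟨_, Finset.mem_filter.2 ⟨Finset.mem_univ _, isPsi_zero n, rfl⟩⟩
  refine ⟨(F b₀).card * (s * s : ℂ), ?_, ?_⟩
  · have : ((F b₀).card : ℂ) ≠ 0 := by exact_mod_cast h0.ne'
    have : (s : ℂ) ≠ 0 := by exact_mod_cast hs0
    positivity
  · ext b b'
    rw [Matrix.mul_apply, Matrix.smul_apply, Matrix.one_apply]
    simp only [Matrix.conjTranspose_apply, encoding_apply, ← hs]
    by_cases hb : b = b'
    · subst hb
      rw [if_pos rfl, smul_eq_mul, mul_one, le_antisymm (hF b₀ b) (hF b b₀), ← nsmul_eq_mul,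
        ← Finset.sum_const, Finset.sum_filter]
      refine Finset.sum_congr rfl fun α _ => ?_
      split_ifs
      · rw [Complex.star_def, Complex.conj_ofReal]
      · simp
    · rw [if_neg hb, smul_zero]
      refine Finset.sum_eq_zero fun α _ => ?_
      by_cases h1 : IsPsi n α ∧ pattern n α = b
      · rw [if_neg (c := IsPsi n α ∧ pattern n α = b') fun h2 => hb (h1.2.symm.trans h2.2),
          mul_zero]
      · rw [if_neg h1, star_zero, zero_mul]

/-- The physical operator `O` acts on the code states as the logical operator `N`, and so does its
adjoint with the adjoint of `N`. -/
def Implements (n : ℕ) (O : Matrix (Site n → Fin 4) (Site n → Fin 4) ℂ)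
    (N : Matrix (Hole n → Fin 4) (Hole n → Fin 4) ℂ) : Prop :=
  O * encoding n = encoding n * N ∧ (encoding n)ᴴ * O = N * (encoding n)ᴴ

theorem Implements.commute {n : ℕ} {O : Matrix (Site n → Fin 4) (Site n → Fin 4) ℂ}
    {N : Matrix (Hole n → Fin 4) (Hole n → Fin 4) ℂ} (h : Implements n O N) :
    Commute O (codeProj n) := by
  rw [commute_iff_eq, codeProj, ← Matrix.mul_assoc, h.1, Matrix.mul_assoc, Matrix.mul_assoc, h.2]

theorem SupportedOn.smul {ι : Type} [Fintype ι] [DecidableEq ι] {A : Finset ι}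
    {O : Matrix (ι → Fin 4) (ι → Fin 4) ℂ} (h : SupportedOn A O) (c : ℂ) :
    SupportedOn A (c • O) := by
  obtain ⟨M, hM⟩ := h
  refine ⟨c • M, fun α β => ?_⟩
  rw [Matrix.smul_apply, hM]
  split_ifs
  · rfl
  · exact smul_zero c

theorem Implements.reconstructibleOn {n : ℕ} {O : Matrix (Site n → Fin 4) (Site n → Fin 4) ℂ}
    {N : Matrix (Hole n → Fin 4) (Hole n → Fin 4) ℂ} (h : Implements n O N) {A : Finset (Site n)}
    (hO : SupportedOn A O) : ReconstructibleOn n A (encoding n * N * (encoding n)ᴴ) := by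
  obtain ⟨c, hc, e⟩ := exists_conjTranspose_mul_encoding n
  refine ⟨c⁻¹ • O, hO.smul _, h.commute.smul_left _, ?_⟩
  have : codeProj n * O * codeProj n = c • (encoding n * N * (encoding n)ᴴ) := by
    calc codeProj n * O * codeProj n
        = encoding n * ((encoding n)ᴴ * O) * encoding n * (encoding n)ᴴ := by
          simp only [codeProj, Matrix.mul_assoc]
      _ = encoding n * N * ((encoding n)ᴴ * encoding n) * (encoding n)ᴴ := by
          rw [h.2]; simp only [Matrix.mul_assoc]
      _ = c • (encoding n * N * (encoding n)ᴴ) := by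
          rw [e, Matrix.mul_smul, Matrix.mul_one, Matrix.smul_mul]
  rw [Matrix.mul_smul, Matrix.smul_mul, this, smul_smul, inv_mul_cancel₀ hc, one_smul]

/-- An operator whose matrix elements vanish between configurations that differ outside `A`, and
otherwise depend only on the restrictions of the configurations to `A`, is supported on `A`. -/
theorem supportedOn_of_congr {ι : Type} [Fintype ι] [DecidableEq ι] {A : Finset ι}
    {O : Matrix (ι → Fin 4) (ι → Fin 4) ℂ}
    (h0 : ∀ α β, O α β ≠ 0 → ∀ i, i ∉ A → α i = β i)
    (h : ∀ α β α' β', (∀ i, i ∉ A → α i = β i) → (∀ i, i ∉ A → α' i = β' i) →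
      (∀ i ∈ A, α i = α' i) → (∀ i ∈ A, β i = β' i) → O α β = O α' β') :
    SupportedOn A O := by
  let E (α : A → Fin 4) : ι → Fin 4 := fun i => if hi : i ∈ A then α ⟨i, hi⟩ else 0
  refine ⟨fun α β => O (E α) (E β), fun α β => ?_⟩
  split_ifs with hc
  · refine h _ _ _ _ hc (fun i hi => ?_) (fun i hi => ?_) fun i hi => ?_ <;> simp [E, hi]
  · by_contra hne
    exact hc (h0 α β hne)

/-- Operators with disjoint supports commute. -/
theorem SupportedOn.commute {ι : Type} [Fintype ι] [DecidableEq ι] {B : Finset ι}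
    {D O : Matrix (ι → Fin 4) (ι → Fin 4) ℂ} (hD : SupportedOn B D) (hO : SupportedOn Bᶜ O) :
    Commute D O := by
  obtain ⟨M, hM⟩ := hD
  obtain ⟨M', hM'⟩ := hO
  have hM' (α β : ι → Fin 4) : O α β = if ∀ i ∈ B, α i = β i then
      M' (fun i => α i) (fun i => β i) else 0 := by
    rw [hM']; simp only [Finset.mem_compl, not_not]
  ext α β
  rw [Matrix.mul_apply, Matrix.mul_apply,
    Finset.sum_eq_single (fun i => if i ∈ B then β i else α i),
    Finset.sum_eq_single (fun i => if i ∈ B then α i else β i)]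
  · rw [hM, hM', hM', hM, if_pos, if_pos, if_pos, if_pos, mul_comm]
    · congr 2
      · funext i; rw [if_neg (Finset.mem_compl.1 i.2)]
      · funext i; rw [if_neg (Finset.mem_compl.1 i.2)]
      · funext i; rw [if_pos i.2]
      · funext i; rw [if_pos i.2]
    all_goals intro i hi; simp [hi]
  · intro γ _ hγ
    by_contra hne
    refine hγ (funext fun i => ?_)
    have h1 := left_ne_zero_of_mul hne
    have h2 := right_ne_zero_of_mul hne
    rw [hM', ite_ne_right_iff] at h1
    rw [hM, ite_ne_right_iff] at h2
    split_ifs with hi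
    · exact (h1.1 i hi).symm
    · exact h2.1 i hi
  · exact fun hn => absurd (Finset.mem_univ _) hn
  · intro γ _ hγ
    by_contra hne
    refine hγ (funext fun i => ?_)
    have h1 := left_ne_zero_of_mul hne
    have h2 := right_ne_zero_of_mul hne
    rw [hM, ite_ne_right_iff] at h1
    rw [hM', ite_ne_right_iff] at h2
    split_ifs with hi
    · exact h2.1 i hi
    · exact (h1.1 i hi).symm
  · exact fun hn => absurd (Finset.mem_univ _) hn

/-- If some operator on `B` acts on the code as the logical operator `N`, a logical operator which
does not commute with `N` cannot be reconstructed on the complement of `B`. -/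
theorem Implements.not_reconstructibleOn {n : ℕ}
    {D : Matrix (Site n → Fin 4) (Site n → Fin 4) ℂ}
    {N N' : Matrix (Hole n → Fin 4) (Hole n → Fin 4) ℂ} (h : Implements n D N)
    {B : Finset (Site n)} (hD : SupportedOn B D) (hN : ¬ Commute N N') :
    ¬ ReconstructibleOn n Bᶜ (encoding n * N' * (encoding n)ᴴ) := by
  rintro ⟨O, hO, -, e⟩
  obtain ⟨c, hc, hR⟩ := exists_conjTranspose_mul_encoding n
  have hcomm : Commute D (encoding n * N' * (encoding n)ᴴ) := by
    rw [e]
    exact (h.commute.mul_right (hD.commute hO)).mul_right h.commute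
  have h2 : (encoding n)ᴴ * (D * (encoding n * N' * (encoding n)ᴴ)) * encoding n =
      (encoding n)ᴴ * (encoding n * N' * (encoding n)ᴴ * D) * encoding n := by rw [hcomm.eq]
  have h3 : (encoding n)ᴴ * (D * (encoding n * N' * (encoding n)ᴴ)) * encoding n =
      (c * c) • (N * N') := by
    calc _ = ((encoding n)ᴴ * D) * encoding n * N' * ((encoding n)ᴴ * encoding n) := by
          simp only [Matrix.mul_assoc]
      _ = N * ((encoding n)ᴴ * encoding n) * N' * ((encoding n)ᴴ * encoding n) := by
          rw [h.2]; simp only [Matrix.mul_assoc]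
      _ = _ := by simp [hR, smul_smul]
  have h4 : (encoding n)ᴴ * (encoding n * N' * (encoding n)ᴴ * D) * encoding n =
      (c * c) • (N' * N) := by
    calc _ = ((encoding n)ᴴ * encoding n) * N' * ((encoding n)ᴴ * (D * encoding n)) := by
          simp only [Matrix.mul_assoc]
      _ = ((encoding n)ᴴ * encoding n) * N' * ((encoding n)ᴴ * encoding n) * N := by
          rw [h.1]; simp only [Matrix.mul_assoc]
      _ = _ := by simp [hR, smul_smul]
  rw [h3, h4] at h2
  exact hN (smul_right_injective _ (mul_ne_zero hc hc) h2)

theorem localOp_conjTranspose {ι : Type} [Fintype ι] [DecidableEq ι] (i : ι)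
    (M : Matrix (Fin 4) (Fin 4) ℂ) : (localOp i M)ᴴ = localOp i Mᴴ := by
  ext α β
  rw [Matrix.conjTranspose_apply, localOp_apply, localOp_apply, Matrix.conjTranspose_apply,
    apply_ite star, star_zero]
  simp only [eq_comm]

theorem localOp_diagonal {ι : Type} [Fintype ι] [DecidableEq ι] (i : ι) (d : Fin 4 → ℂ) :
    localOp i (Matrix.diagonal d) = Matrix.diagonal fun α : ι → Fin 4 => d (α i) := by
  ext α β
  rw [localOp_apply]
  by_cases h : α = β
  · subst h; simp
  · rw [Matrix.diagonal_apply_ne _ h]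
    split_ifs with h'
    · refine Matrix.diagonal_apply_ne _ fun h'' => h (funext fun j => ?_)
      by_cases hj : j = i
      · rw [hj, h'']
      · exact h' j hj
    · rfl

theorem not_commute_localOp {ι : Type} [Fintype ι] [DecidableEq ι] (i : ι) {k : Fin 4}
    {d : Fin 4 → ℂ} (h : d k ≠ d 0) :
    ¬ Commute (localOp i (S k)) (localOp i (Matrix.diagonal d)) := by
  intro hc
  have h1 := congrFun (congrFun hc.eq (point i k)) fun _ => 0
  have h2 : localOp i (S k) (point i k) (fun _ => 0) = 1 := by
    rw [localOp_S_apply, xadd_comm, xadd_zero, if_pos rfl]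
  rw [localOp_diagonal, Matrix.mul_diagonal, Matrix.diagonal_mul, h2, one_mul, mul_one] at h1
  exact h (by simpa [point] using h1.symm)

theorem implements_of_mul_encoding {n : ℕ} {O : Matrix (Site n → Fin 4) (Site n → Fin 4) ℂ}
    {N : Matrix (Hole n → Fin 4) (Hole n → Fin 4) ℂ} (h : O * encoding n = encoding n * N)
    (h' : Oᴴ * encoding n = encoding n * Nᴴ) : Implements n O N := by
  refine ⟨h, ?_⟩
  have := congrArg Matrix.conjTranspose h'
  simpa only [Matrix.conjTranspose_mul, Matrix.conjTranspose_conjTranspose] using this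

/-- For a function `f` reading off the value at a hole and shifts `e v` adding `v` to this value,
the operator with the matrix elements of `M` between the values of configurations that differ by
the corresponding shift. -/
def liftOp {ι : Type} [Fintype ι] (f : (ι → Fin 4) → Fin 4) (e : Fin 4 → ι → Fin 4)
    (M : Matrix (Fin 4) (Fin 4) ℂ) : Matrix (ι → Fin 4) (ι → Fin 4) ℂ :=
  fun α β => if α = β ∔ e (f α ^^^ f β) then M (f α) (f β) else 0

theorem liftOp_conjTranspose {ι : Type} [Fintype ι] (f : (ι → Fin 4) → Fin 4)
    (e : Fin 4 → ι → Fin 4) (M : Matrix (Fin 4) (Fin 4) ℂ) : (liftOp f e M)ᴴ = liftOp f e Mᴴ := by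
  ext α β
  rw [Matrix.conjTranspose_apply, liftOp, liftOp, apply_ite star, star_zero,
    Matrix.conjTranspose_apply]
  congr 1
  rw [eq_xadd_iff, fin4_xor_comm]

theorem supportedOn_liftOp {ι : Type} [Fintype ι] [DecidableEq ι] {A : Finset ι}
    {f : (ι → Fin 4) → Fin 4} {e : Fin 4 → ι → Fin 4} (M : Matrix (Fin 4) (Fin 4) ℂ)
    (hf : ∀ α β, (∀ i ∈ A, α i = β i) → f α = f β) (he : ∀ v, ∀ i ∉ A, e v i = 0) :
    SupportedOn A (liftOp f e M) := by
  refine supportedOn_of_congr (fun α β h i hi => ?_) fun α β α' β' h h' hα hβ => ?_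
  · rw [liftOp, ite_ne_right_iff] at h
    have := congrFun h.1 i
    rwa [xadd, he _ i hi, fin4_xor_zero] at this
  · rw [liftOp, liftOp, hf α α' hα, hf β β' hβ]
    congr 1
    rw [eq_iff_iff, funext_iff, funext_iff]
    refine forall_congr' fun i => ?_
    by_cases hi : i ∈ A
    · rw [xadd, xadd, hα i hi, hβ i hi]
    · rw [xadd, xadd, he _ i hi, fin4_xor_zero, fin4_xor_zero, h i hi, h' i hi]
      simp

theorem liftOp_mul_encoding {n : ℕ} (x : Hole n) (M : Matrix (Fin 4) (Fin 4) ℂ)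
    {f : (Site n → Fin 4) → Fin 4} {e : Fin 4 → Site n → Fin 4}
    (hf : ∀ α, IsPsi n α → f α = pattern n α x) (he : ∀ v, IsShift n (e v) (point x v)) :
    liftOp f e M * encoding n = encoding n * localOp x M := by
  classical
  ext α b
  rw [Matrix.mul_apply, Matrix.mul_apply]
  by_cases hα : IsPsi n α
  · -- The only state entering on the left is the shift of `α` with the value `b x` at `x`, the
    -- only pattern entering on the right is that of `α`.
    rw [Finset.sum_eq_single (α ∔ e (f α ^^^ b x)), Finset.sum_eq_single (pattern n α)]
    · obtain ⟨h1, h2⟩ := he (f α ^^^ b x) α hα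
      have h3 : f (α ∔ e (f α ^^^ b x)) = b x := by
        rw [hf _ h1, h2, xadd, ← hf α hα, point, if_pos rfl, ← fin4_xor_assoc, fin4_xor_self,
          fin4_zero_xor]
      have h4 : pattern n (α ∔ e (f α ^^^ b x)) = b ↔ ∀ y, y ≠ x → pattern n α y = b y := by
        rw [h2, funext_iff]
        refine forall_congr' fun y => ?_
        by_cases hy : y = x
        · subst hy
          simp only [xadd, point, if_true, ← hf α hα, ← fin4_xor_assoc, fin4_xor_self,
            fin4_zero_xor, ne_eq, not_true_eq_false, false_implies]
        · simp only [xadd, point, hy, if_false, fin4_xor_zero, ne_eq, not_false_eq_true,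
            true_implies]
      rw [liftOp, h3, if_pos (xadd_xadd_cancel _ _).symm, encoding_apply, encoding_apply,
        if_pos (⟨hα, rfl⟩ : IsPsi n α ∧ pattern n α = pattern n α), localOp_apply, hf α hα]
      rw [hf α hα] at h1 h4
      simp only [h1, h4, true_and]
      split_ifs
      · exact mul_comm _ _
      · simp
    · intro b' _ hb'
      rw [encoding_apply, if_neg fun h => hb' h.2.symm, zero_mul]
    · exact fun hn => absurd (Finset.mem_univ _) hn
    · intro γ _ hγ
      rw [encoding_apply]
      split_ifs with h
      · rw [liftOp, if_neg, zero_mul]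
        rw [eq_xadd_iff, hf γ h.1, h.2]
        exact hγ
      · exact mul_zero _
    · exact fun hn => absurd (Finset.mem_univ _) hn
  · rw [Finset.sum_eq_zero, Finset.sum_eq_zero]
    · intro b' _
      rw [encoding_apply, if_neg fun h => hα h.1, zero_mul]
    · intro γ _
      by_contra hne
      have h1 := left_ne_zero_of_mul hne
      have h2 := right_ne_zero_of_mul hne
      rw [liftOp, ite_ne_right_iff] at h1
      rw [encoding_apply, ite_ne_right_iff] at h2
      exact hα (h1.1 ▸ (he _ γ h2.1.1).1)

/-- The algebra of the bulk qudit `x` is reconstructed on `A` as soon as its value can be read off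
and shifted on `A`. -/
theorem reconstructibleOn_of_shifts {n : ℕ} (x : Hole n) {A : Finset (Site n)}
    {f : (Site n → Fin 4) → Fin 4} (hfA : ∀ α β, (∀ i ∈ A, α i = β i) → f α = f β)
    (hf : ∀ α, IsPsi n α → f α = pattern n α x)
    (he : ∀ v, ∃ τ, IsShift n τ (point x v) ∧ ∀ i ∉ A, τ i = 0) :
    ∀ L ∈ bulkAlgebra n x, ReconstructibleOn n A L := by
  choose e he heA using he
  rintro _ ⟨M, rfl⟩
  refine Implements.reconstructibleOn (implements_of_mul_encoding
    (liftOp_mul_encoding x M hf he) ?_) (supportedOn_liftOp M hfA heA)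
  rw [liftOp_conjTranspose, localOp_conjTranspose]
  exact liftOp_mul_encoding x _ hf he

theorem implements_diagonal {n : ℕ} (x : Hole n) {g : (Site n → Fin 4) → ℂ} {d : Fin 4 → ℂ}
    (h : ∀ α, IsPsi n α → g α = d (pattern n α x)) :
    Implements n (Matrix.diagonal g) (localOp x (Matrix.diagonal d)) := by
  have key (g : (Site n → Fin 4) → ℂ) (d : Fin 4 → ℂ)
      (h : ∀ α, IsPsi n α → g α = d (pattern n α x)) :
      Matrix.diagonal g * encoding n = encoding n * localOp x (Matrix.diagonal d) := by
    ext α b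
    rw [localOp_diagonal, Matrix.diagonal_mul, Matrix.mul_diagonal, encoding_apply]
    split_ifs with hα
    · rw [h α hα.1, hα.2, mul_comm]
    · rw [mul_zero, zero_mul]
  refine implements_of_mul_encoding (key g d h) ?_
  rw [localOp_conjTranspose, Matrix.diagonal_conjTranspose, Matrix.diagonal_conjTranspose]
  exact key _ _ fun α hα => congrArg star (h α hα)

theorem implements_gate (n : ℕ) (x : Hole n) (b : Fin 3) :
    Implements n (gate n x b) (localOp x (S (label (b + 2)))) := by
  have h1 : (gate n x b)ᴴ = gate n x b := by
    ext α β
    rw [Matrix.conjTranspose_apply, gate_apply, gate_apply, apply_ite star, star_zero, star_one]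
    simp only [eq_xadd_iff (α := α)]
  have h2 : (localOp x (S (label (b + 2))))ᴴ = localOp x (S (label (b + 2))) := by
    ext α β
    rw [Matrix.conjTranspose_apply, localOp_S_apply, localOp_S_apply, apply_ite star, star_zero,
      star_one]
    simp only [eq_xadd_iff (α := α)]
  have h3 : gate n x b * encoding n = encoding n * localOp x (S (label (b + 2))) := by
    ext α c
    simp only [Matrix.mul_apply, gate_apply, localOp_S_apply, eq_xadd_iff (α := α), ite_mul,
      mul_ite, one_mul, mul_one, zero_mul, mul_zero, Finset.sum_ite_eq', Finset.mem_univ,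
      if_true]
    rw [encoding_apply, encoding_apply]
    have hs := isShift_excitation n x b
    congr 1
    rw [eq_iff_iff]
    constructor
    · rintro ⟨h, rfl⟩
      obtain ⟨h', e⟩ := hs _ h
      rw [xadd_xadd_cancel] at h' e
      exact ⟨h', e⟩
    · rintro ⟨h, e⟩
      refine ⟨(hs α h).1, ?_⟩
      rw [(hs α h).2, e, xadd_xadd_cancel]
  exact implements_of_mul_encoding h3 (by rw [h1, h2, h3])

theorem supportedOn_gate (n : ℕ) (x : Hole n) (b : Fin 3) {B : Finset (Site n)}
    (h1 : (pair n x b).1.1 ∈ B) (h2 : (pair n x b).2.1 ∈ B) : SupportedOn B (gate n x b) := by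
  have h0 (i : Site n) (hi : i ∉ B) : excitation n x b i = 0 := by
    have e1 : i ≠ (pair n x b).1.1 := fun e => hi (e ▸ h1)
    have e2 : i ≠ (pair n x b).2.1 := fun e => hi (e ▸ h2)
    rw [excitation, xadd, point, point, if_neg e1, if_neg e2, fin4_xor_zero]
  refine supportedOn_of_congr (fun α β h i hi => ?_) fun α β α' β' h h' hα hβ => ?_
  · rw [gate_apply, ite_ne_right_iff] at h
    have := congrFun h.1 i
    rwa [xadd, h0 i hi, fin4_xor_zero] at this
  · rw [gate_apply, gate_apply]
    congr 1
    rw [eq_iff_iff, funext_iff, funext_iff]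
    refine forall_congr' fun i => ?_
    by_cases hi : i ∈ B
    · rw [xadd, xadd, hα i hi, hβ i hi]
    · rw [xadd, xadd, h0 i hi, fin4_xor_zero, fin4_xor_zero, h i hi, h' i hi]
      simp

/-! ### Positions on the ring -/

theorem card_site : ∀ n, Fintype.card (Site n) = 3 ^ n
  | 0 => rfl
  | n + 1 => by
    have : Fintype.card (Site (n + 1)) = Fintype.card (Fin 3 × Site n) := rfl
    rw [this, Fintype.card_prod, Fintype.card_fin, card_site n, pow_succ, mul_comm]

theorem position_lt : ∀ (n : ℕ) (i : Site n), position n i < 3 ^ n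
  | 0, _ => Nat.one_pos
  | n + 1, (a, w) => by
    have h1 := position_lt n w
    have h2 := a.isLt
    have h3 : position (n + 1) (a, w) = a.val * 3 ^ n + position n w := rfl
    rw [h3, pow_succ]
    nlinarith

theorem position_injective : ∀ n, Function.Injective (position n)
  | 0, _, _, _ => rfl
  | n + 1, (a, v), (b, w), h => by
    have h : a.val * 3 ^ n + position n v = b.val * 3 ^ n + position n w := h
    have hv := position_lt n v
    have hw := position_lt n w
    have h1 : position n v = position n w := by
      have := congrArg (· % 3 ^ n) h
      simpa [Nat.mod_eq_of_lt hv, Nat.mod_eq_of_lt hw] using this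
    have h2 : a.val * 3 ^ n = b.val * 3 ^ n := by omega
    have h3 : a = b := Fin.ext (Nat.eq_of_mul_eq_mul_right (by positivity) h2)
    rw [h3, position_injective n h1]

theorem exists_position_eq {n p : ℕ} (hp : p < 3 ^ n) : ∃ i, position n i = p := by
  let g : Site n → Fin (3 ^ n) := fun i => ⟨position n i, position_lt n i⟩
  have hg : Function.Injective g := fun i j h => position_injective n (Fin.mk.inj h)
  have := ((Fintype.bijective_iff_injective_and_card g).2 ⟨hg, by simp [card_site]⟩).2 ⟨p, hp⟩
  exact this.imp fun i hi => Fin.mk.inj hi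

/-- The connected subregion of the sites `s, …, s + l - 1`. -/
def segment (n s l : ℕ) : Finset (Site n) :=
  Finset.univ.filter fun i => s ≤ position n i ∧ position n i < s + l

theorem mem_segment {n s l : ℕ} {i : Site n} :
    i ∈ segment n s l ↔ s ≤ position n i ∧ position n i < s + l := by simp [segment]

theorem isArc_segment {n s l : ℕ} (h : s + l ≤ 3 ^ n) : IsArc n (segment n s l) := by
  refine ⟨s, l, fun i => ?_⟩
  rw [mem_segment]
  constructor
  · rintro ⟨h1, h2⟩
    refine ⟨position n i - s, by omega, ?_⟩
    rw [Nat.add_sub_cancel' h1]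
  · rintro ⟨k, hk, h1⟩
    have := Nat.ModEq.eq_of_lt_of_lt h1 (position_lt n i) (by omega)
    omega

theorem card_segment {n s l : ℕ} (h : s + l ≤ 3 ^ n) : (segment n s l).card = l := by
  rw [← Finset.card_image_of_injective _ (position_injective n)]
  have : (segment n s l).image (position n) = Finset.Ico s (s + l) := by
    ext p
    rw [Finset.mem_image, Finset.mem_Ico]
    constructor
    · rintro ⟨i, hi, rfl⟩
      exact mem_segment.1 hi
    · intro hp
      obtain ⟨i, rfl⟩ := exists_position_eq (n := n) (p := p) (by omega)
      exact ⟨i, mem_segment.2 hp, rfl⟩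
  rw [this, Nat.card_Ico, Nat.add_sub_cancel_left]

/-- Two sites of a connected subregion are close to each other on the ring. -/
theorem IsArc.position_sub {n c : ℕ} {B : Finset (Site n)} (hB : IsArc n B) (hc : B.card ≤ c)
    (hcn : c < 3 ^ n) {i j : Site n} (hi : i ∈ B) (hj : j ∈ B) :
    position n j < position n i + c ∨ position n i + 3 ^ n < position n j + c := by
  obtain ⟨s, l, h⟩ := hB
  have hl : l ≤ c := by
    by_contra! hl
    -- The first `c + 1` sites of the arc are distinct.
    have hex (k : ℕ) : ∃ i, position n i = (s + k) % 3 ^ n :=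
      exists_position_eq (Nat.mod_lt _ (by positivity))
    choose g hg using hex
    have : (Finset.range (c + 1)).card ≤ B.card := by
      refine Finset.card_le_card_of_injOn g (fun k hk => ?_) fun k hk k' hk' e => ?_
      · have hk := Finset.mem_range.1 (Finset.mem_coe.1 hk)
        exact (h _).2 ⟨k, by omega, by rw [hg]; exact Nat.mod_modEq _ _⟩
      · have hk := Finset.mem_range.1 (Finset.mem_coe.1 hk)
        have hk' := Finset.mem_range.1 (Finset.mem_coe.1 hk')
        have h1 : s + k ≡ s + k' [MOD 3 ^ n] := by
          rw [Nat.ModEq, ← hg, ← hg, e]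
        exact Nat.ModEq.eq_of_lt_of_lt (Nat.ModEq.add_left_cancel' s h1) (by omega) (by omega)
    rw [Finset.card_range] at this
    omega
  obtain ⟨k, hk, h1⟩ := (h i).1 hi
  obtain ⟨k', hk', h2⟩ := (h j).1 hj
  have hi := position_lt n i
  have hj := position_lt n j
  have h3 : position n i + k' ≡ position n j + k [MOD 3 ^ n] := by
    have := (h1.add_right k').trans (b := s + k + k') rfl
    refine this.trans ?_
    have := h2.symm.add_right k
    rwa [show s + k' + k = s + k + k' by ring] at this
  by_contra! hcon
  obtain ⟨h4, h5⟩ := hcon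
  -- The difference of the two sides is positive and less than the length of the ring.
  have h6 := (Nat.modEq_iff_dvd' (by omega)).1 h3
  have h7 := Nat.le_of_dvd (by omega) h6
  omega

/-! ### Supports of gates and of detours -/

theorem position_corner_one : ∀ n, 2 * position n (corner n 1) + 1 = 3 ^ n
  | 0 => rfl
  | n + 1 => by
    have h : position (n + 1) (corner (n + 1) 1) = 1 * 3 ^ n + position n (corner n 1) := rfl
    have := position_corner_one n
    rw [h, pow_succ]
    omega

theorem lateralBit_congr : ∀ (n : ℕ) (c : Fin 3) {α β : Site n → Fin 4},
    (∀ i, (c = 0 → 3 ^ n ≤ 2 * position n i + 1) → (c = 2 → 2 * position n i + 1 ≤ 3 ^ n) →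
      α i = β i) → lateralBit n c α = lateralBit n c β
  | 0, c, α, β, h => by
    rw [lateralBit_zero, lateralBit_zero, h ()] <;> exact fun _ => le_rfl
  | n + 1, c, α, β, h => by
    have hp (b : Fin 3) (w : Site n) :
      position (n + 1) (b, w) = b.val * 3 ^ n + position n w := rfl
    have h3 : 3 ^ (n + 1) = 3 * 3 ^ n := by rw [pow_succ, mul_comm]
    rw [lateralBit_succ, lateralBit_succ]
    congr 1
    · refine lateralBit_congr n 0 fun w h0 _ => h (c + 1, w) ?_ ?_
      · rintro rfl
        have := h0 rfl
        rw [hp, h3, show (0 + 1 : Fin 3).val = 1 from rfl]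
        omega
      · rintro rfl
        have := position_lt n w
        rw [hp, h3, show (2 + 1 : Fin 3).val = 0 from rfl]
        omega
    · refine lateralBit_congr n 2 fun w _ h0 => h (c + 2, w) ?_ ?_
      · rintro rfl
        rw [hp, h3, show (0 + 2 : Fin 3).val = 2 from rfl]
        omega
      · rintro rfl
        have := h0 rfl
        rw [hp, h3, show (2 + 2 : Fin 3).val = 1 from rfl]
        omega

/-- The detour of a block runs through the sites between the outward corners of its sub-blocks `0`
and `2`. -/
theorem detourBit_congr {k t : ℕ} (ht : 2 * t + 1 = 3 ^ k) {α β : Site (k + 1) → Fin 4}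
    (h : ∀ i, t ≤ position (k + 1) i → position (k + 1) i ≤ 2 * 3 ^ k + t → α i = β i) :
    detourBit (k + 1) α = detourBit (k + 1) β := by
  have hp (b : Fin 3) (w : Site k) : position (k + 1) (b, w) = b.val * 3 ^ k + position k w := rfl
  rw [detourBit, detourBit]
  congr 1
  · congr 1
    · refine lateralBit_congr k 0 fun w h0 _ => h (0, w) ?_ ?_
      · have := h0 rfl
        rw [hp, show (0 : Fin 3).val = 0 from rfl]; omega
      · have := position_lt k w
        rw [hp, show (0 : Fin 3).val = 0 from rfl]; omega
    · refine lateralBit_congr k 1 fun w _ _ => h (1, w) ?_ ?_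
      · rw [hp, show (1 : Fin 3).val = 1 from rfl]; omega
      · have := position_lt k w
        rw [hp, show (1 : Fin 3).val = 1 from rfl]; omega
  · refine lateralBit_congr k 2 fun w _ h0 => h (2, w) ?_ ?_
    · rw [hp, show (2 : Fin 3).val = 2 from rfl]; omega
    · have := h0 rfl
      rw [hp, show (2 : Fin 3).val = 2 from rfl]; omega

/-- The geometry around a hole `x` which is surrounded by blocks of level `k + 1`: for some `o`,
where the sites of these blocks are those from `o` to `o + 9 * 3 ^ k - 1`, the positions of the
ends of the gates at `x` and bounds for those of the sites on the detours. -/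
theorem exists_offset {k t : ℕ} (ht : 2 * t + 1 = 3 ^ k) : ∀ (n : ℕ) (x : Hole n),
    depth n x + (k + 2) = n → ∃ o, o + 9 * 3 ^ k ≤ 3 ^ n ∧
      (∀ a, position n (pair n x a).1.1 = o + (3 * a.val + 2) * 3 ^ k + t ∧
        position n (pair n x a).2.1 = o + 3 * (a + 1).val * 3 ^ k + t) ∧
      ∀ a α β, (∀ i, o + 3 * a.val * 3 ^ k + t ≤ position n i →
        position n i ≤ o + (3 * a.val + 2) * 3 ^ k + t → α i = β i) →
        loopBit detourBit n x a α = loopBit detourBit n x a β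
  | 0, x, _ => x.elim
  | n + 1, none, h => by
    have h0 : depth (n + 1) none = 0 := rfl
    obtain rfl : n = k + 1 := by omega
    have hc := position_corner_one k
    have hp (a : Fin 3) (w : Site (k + 1)) :
      position (k + 2) (a, w) = a.val * 3 ^ (k + 1) + position (k + 1) w := rfl
    have hp' (a : Fin 3) (w : Site k) :
      position (k + 1) (a, w) = a.val * 3 ^ k + position k w := rfl
    have hct : position k (corner k 1) = t := by omega
    refine ⟨0, le_of_eq (by ring), fun a => ⟨?_, ?_⟩, fun a α β hαβ => ?_⟩
    · have e : position (k + 2) (pair (k + 2) none a).1.1 =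
        a.val * 3 ^ (k + 1) + (2 * 3 ^ k + position k (corner k 1)) := rfl
      rw [e, hct]; ring
    · have e : position (k + 2) (pair (k + 2) none a).2.1 =
        (a + 1).val * 3 ^ (k + 1) + (0 * 3 ^ k + position k (corner k 1)) := rfl
      rw [e, hct]; ring
    · refine detourBit_congr ht fun w h1 h2 => hαβ (a, w) ?_ ?_
      · rw [hp, pow_succ]; linarith
      · rw [hp, pow_succ]; linarith
  | n + 1, some (b, y), h => by
    have h0 : depth (n + 1) (some (b, y)) = depth n y + 1 := rfl
    obtain ⟨o, h1, h2, h3⟩ := exists_offset ht n y (by omega)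
    have hp (w : Site n) : position (n + 1) (b, w) = b.val * 3 ^ n + position n w := rfl
    refine ⟨b.val * 3 ^ n + o, ?_, fun a => ⟨?_, ?_⟩, fun a α β hαβ => ?_⟩
    · have := Nat.mul_le_mul_right (3 ^ n) (Nat.le_of_lt_succ b.isLt)
      rw [pow_succ]
      omega
    · refine (hp _).trans ?_
      rw [(h2 a).1]; ring
    · refine (hp _).trans ?_
      rw [(h2 a).2]; ring
    · refine h3 a _ _ fun w hw1 hw2 => hαβ (b, w) ?_ ?_
      · rw [hp]; omega
      · rw [hp]; omega

/-! ### The connected distance -/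

/-- The value at a hole can be read off from the parities of two blocks. -/
theorem pattern_eq_ofBits_ite {φ : ∀ n, (Site n → Fin 4) → ZMod 2} (h : IsCrossing φ) {n : ℕ}
    {α : Site n → Fin 4} (hα : IsPsi n α) (x : Hole n) (c : Fin 3) :
    (ofBits fun a => if a = c then loopBit φ n x (c + 1) α + loopBit φ n x (c + 2) α
      else loopBit φ n x a α) = pattern n α x := by
  rw [pattern_eq_ofBits]
  congr 1
  funext a
  rw [loopBit_eq_of_isPsi isCrossing_lateralBit h hα]
  split_ifs with ha
  · subst ha
    have hs := loopBit_sum_eq_zero h hα x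
    rw [Fin.sum_univ_three] at hs
    have key : ∀ (g : Fin 3 → ZMod 2) (a : Fin 3), g 0 + g 1 + g 2 = 0 →
      g a = g (a + 1) + g (a + 2) := by decide
    exact (key (loopBit φ n x · α) a hs).symm
  · rfl

/-- Any two of the three gates at a hole generate all the shifts of its value. -/
theorem exists_isShift_of_gates {n : ℕ} (x : Hole n) {B : Finset (Site n)} (c : Fin 3)
    (h : ∀ b, b ≠ c → (pair n x b).1.1 ∉ B ∧ (pair n x b).2.1 ∉ B) (v : Fin 4) :
    ∃ τ, IsShift n τ (point x v) ∧ ∀ i ∈ B, τ i = 0 := by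
  have h0 (b : Fin 3) (hb : b ≠ c) (i : Site n) (hi : i ∈ B) : excitation n x b i = 0 := by
    obtain ⟨h1, h2⟩ := h b hb
    have e1 : i ≠ (pair n x b).1.1 := fun e => h1 (e ▸ hi)
    have e2 : i ≠ (pair n x b).2.1 := fun e => h2 (e ▸ hi)
    rw [excitation, xadd, point, point, if_neg e1, if_neg e2, fin4_xor_zero]
  have hv : v = 0 ∨ (∃ b, b ≠ c ∧ v = label (b + 2)) ∨
      v = label (c + 1 + 2) ^^^ label (c + 2 + 2) := by
    clear h0 h; revert v c; decide
  rcases hv with rfl | ⟨b, hb, rfl⟩ | rfl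
  · refine ⟨fun _ => 0, ?_, fun _ _ => rfl⟩
    convert isShift_zero n using 1
    funext y; simp [point]
  · exact ⟨_, isShift_excitation n x b, h0 b hb⟩
  · refine ⟨excitation n x (c + 1) ∔ excitation n x (c + 2), ?_, fun i hi => ?_⟩
    · convert (isShift_excitation n x (c + 1)).xadd (isShift_excitation n x (c + 2)) using 1
      funext y
      by_cases hy : y = x <;> simp [xadd, point, hy]
    · have h1 : ∀ c : Fin 3, c + 1 ≠ c ∧ c + 2 ≠ c := by decide
      rw [xadd, h0 _ (h1 c).1 i hi, h0 _ (h1 c).2 i hi, fin4_xor_zero]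

/-- A connected subregion of at most `3 ^ k` sites meets at most one of the three detours around
the hole and at most one of its three gates; the two others of each kind generate all the logical
operators of the hole. -/
theorem reconstructibleOn_compl_of_card_le {n k : ℕ} (x : Hole n) (hx : depth n x + (k + 2) = n)
    {B : Finset (Site n)} (hB : IsArc n B) (hc : B.card ≤ 3 ^ k) :
    ∀ L ∈ bulkAlgebra n x, ReconstructibleOn n Bᶜ L := by
  have ht := position_corner_one k
  set t := position k (corner k 1)
  obtain ⟨o, h1, h2, h3⟩ := exists_offset ht n x hx
  have hpos : 0 < 3 ^ k := by positivity
  have hclose {i j : Site n} (hi : i ∈ B) (hj : j ∈ B) :=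
    hB.position_sub hc (by omega) hi hj
  obtain ⟨c, hcB⟩ : ∃ c : Fin 3, ∀ a, a ≠ c → ∀ i ∈ B, ¬ (o + 3 * a.val * 3 ^ k + t ≤
      position n i ∧ position n i ≤ o + (3 * a.val + 2) * 3 ^ k + t) := by
    by_contra! hcon
    obtain ⟨a, -, i, hi, hai⟩ := hcon 0
    obtain ⟨b, hb, j, hj, hbj⟩ := hcon a
    have h4 := hclose hi hj
    have h5 := hclose hj hi
    fin_cases a <;> fin_cases b <;> simp at hb hai hbj <;> omega
  obtain ⟨d, hdB⟩ : ∃ d : Fin 3, ∀ b, b ≠ d → (pair n x b).1.1 ∉ B ∧ (pair n x b).2.1 ∉ B := by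
    have key (a b : Fin 3) (hab : b ≠ a) {i j : Site n} (hi : i ∈ B) (hj : j ∈ B)
        (hia : i = (pair n x a).1.1 ∨ i = (pair n x a).2.1)
        (hjb : j = (pair n x b).1.1 ∨ j = (pair n x b).2.1) : False := by
      have h4 := hclose hi hj
      have h5 := hclose hj hi
      have h6 : position n i = o + (3 * a.val + 2) * 3 ^ k + t ∨
          position n i = o + 3 * (a + 1).val * 3 ^ k + t :=
        hia.imp (fun e => by rw [e, (h2 a).1]) fun e => by rw [e, (h2 a).2]
      have h7 : position n j = o + (3 * b.val + 2) * 3 ^ k + t ∨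
          position n j = o + 3 * (b + 1).val * 3 ^ k + t :=
        hjb.imp (fun e => by rw [e, (h2 b).1]) fun e => by rw [e, (h2 b).2]
      clear h2 h3 hcB hia hjb
      fin_cases a <;> fin_cases b <;> simp at hab h6 h7 <;> omega
    by_contra! hcon
    obtain ⟨a, -, ha⟩ := hcon 0
    obtain ⟨b, hb, hb'⟩ := hcon a
    by_cases ha1 : (pair n x a).1.1 ∈ B <;> by_cases hb1 : (pair n x b).1.1 ∈ B
    · exact key a b hb ha1 hb1 (.inl rfl) (.inl rfl)
    · exact key a b hb ha1 (hb' hb1) (.inl rfl) (.inr rfl)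
    · exact key a b hb (ha ha1) hb1 (.inr rfl) (.inl rfl)
    · exact key a b hb (ha ha1) (hb' hb1) (.inr rfl) (.inr rfl)
  refine reconstructibleOn_of_shifts x (fun α β h => ?_)
    (fun α hα => pattern_eq_ofBits_ite isCrossing_detourBit hα x c) fun v => ?_
  · have h4 (a : Fin 3) (ha : a ≠ c) :
        loopBit detourBit n x a α = loopBit detourBit n x a β := by
      refine h3 a α β fun i h5 h6 => h i ?_
      rw [Finset.mem_compl]
      exact fun hi => hcB a ha i hi ⟨h5, h6⟩
    have h5 : ∀ c : Fin 3, c + 1 ≠ c ∧ c + 2 ≠ c := by decide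
    congr 1
    funext a
    rw [h4 _ (h5 c).1, h4 _ (h5 c).2]
    split_ifs with ha
    · rfl
    · exact h4 a ha
  · obtain ⟨τ, h4, h5⟩ := exists_isShift_of_gates x d hdB v
    exact ⟨τ, h4, fun i hi => h5 i (by simpa using hi)⟩

theorem reconstructibleOn_univ {n : ℕ} (x : Hole n) :
    ∀ L ∈ bulkAlgebra n x, ReconstructibleOn n Finset.univ L := by
  refine reconstructibleOn_of_shifts x (f := fun α => pattern n α x) (fun α β h => ?_)
    (fun _ _ => rfl) fun v => ?_
  · rw [funext fun i => h i (Finset.mem_univ i)]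
  · obtain ⟨τ, hτ⟩ := exists_isShift_point n x v
    exact ⟨τ, hτ, fun i hi => absurd (Finset.mem_univ i) hi⟩

/-- The ends of a gate at the hole are `3 ^ k` sites apart, and the gate acts as a logical
operator of the hole. -/
theorem isLeast_uncorrectableSizes {n k : ℕ} (x : Hole n) (hx : depth n x + (k + 2) = n) :
    IsLeast (uncorrectableSizes n x) (3 ^ k + 1) := by
  constructor
  · have ht := position_corner_one k
    set t := position k (corner k 1)
    obtain ⟨o, h1, h2, -⟩ := exists_offset ht n x hx
    obtain ⟨h3, h4⟩ := h2 0
    rw [show (0 : Fin 3).val = 0 from rfl] at h3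
    rw [show (0 + 1 : Fin 3).val = 1 from rfl] at h4
    have hle : o + 2 * 3 ^ k + t + (3 ^ k + 1) ≤ 3 ^ n := by omega
    refine ⟨segment n (o + 2 * 3 ^ k + t) (3 ^ k + 1), isArc_segment hle, card_segment hle,
      fun h => ?_⟩
    let d : Fin 4 → ℂ := fun v => if v = 0 then 1 else 0
    refine (implements_gate n x 0).not_reconstructibleOn (supportedOn_gate n x 0 ?_ ?_)
      (not_commute_localOp x (d := d) ?_) (h _ ⟨Matrix.diagonal d, rfl⟩)
    · rw [mem_segment, h3]; omega
    · rw [mem_segment, h4]; omega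
    · simp [d, label]
  · rintro _ ⟨B, hB, rfl, h⟩
    by_contra! hlt
    exact h (reconstructibleOn_compl_of_card_le x hx hB (Nat.le_of_lt_succ hlt))

theorem exists_loopBit_congr : ∀ (n : ℕ) (x : Hole n), depth n x + 1 = n →
    ∃ i : Site n, ∀ α β, α i = β i → loopBit (fun n => lateralBit n 1) n x 0 α =
      loopBit (fun n => lateralBit n 1) n x 0 β
  | 0, x, _ => x.elim
  | n + 1, none, h => by
    have h0 : depth (n + 1) none = 0 := rfl
    obtain rfl : n = 0 := by omega
    refine ⟨(0, ()), fun α β e => ?_⟩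
    rw [loopBit, loopBit, lateralBit_zero, lateralBit_zero]
    exact congrArg (darkBit · 1) e
  | n + 1, some (b, y), h => by
    have h0 : depth (n + 1) (some (b, y)) = depth n y + 1 := rfl
    obtain ⟨i, hi⟩ := exists_loopBit_congr n y (by omega)
    exact ⟨(b, i), fun α β e => hi _ _ e⟩

/-- Each lateral of the loop around a smallest hole is a side of a single qudit, which thus
distinguishes values of the hole. -/
theorem isLeast_uncorrectableSizes_one {n : ℕ} (x : Hole n) (hx : depth n x + 1 = n) :
    IsLeast (uncorrectableSizes n x) 1 := by
  constructor
  · obtain ⟨i, hi⟩ := exists_loopBit_congr n x hx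
    have hle : position n i + 1 ≤ 3 ^ n := position_lt n i
    refine ⟨segment n (position n i) 1, isArc_segment hle, card_segment hle, fun h => ?_⟩
    have hmem : i ∈ segment n (position n i) 1 := mem_segment.2 (by omega)
    let χ : ZMod 2 → ℂ := fun z => if z = 0 then 1 else 0
    refine (implements_diagonal x (d := fun v => χ (darkBit v 0))
      (g := fun α => χ (loopBit (fun n => lateralBit n 1) n x 0 α)) fun α hα => ?_)
      |>.not_reconstructibleOn ?_ ?_ (h _ ⟨S 1, rfl⟩)
    · rw [loopBit_eq_darkBit_pattern isCrossing_lateralBit hα]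
    · refine supportedOn_of_congr (fun α β h j _ => ?_) fun α β α' β' h h' hα hβ => ?_
      · by_contra hne
        exact h (Matrix.diagonal_apply_ne _ fun e => hne (congrFun e j))
      · rw [Matrix.diagonal_apply, Matrix.diagonal_apply, hi α α' (hα i hmem)]
        congr 1
        rw [eq_iff_iff, funext_iff, funext_iff]
        refine forall_congr' fun j => ?_
        by_cases hj : j ∈ segment n (position n i) 1
        · rw [hα j hj, hβ j hj]
        · simp [h j hj, h' j hj]
    · refine fun hc => not_commute_localOp x ?_ hc.symm
      have : darkBit 1 0 = 1 ∧ darkBit 0 0 = 0 := by unfold darkBit; decide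
      simp [χ, this]
  · rintro _ ⟨B, hB, rfl, h⟩
    by_contra! hlt
    obtain rfl : B = ∅ := Finset.card_eq_zero.1 (by omega)
    rw [Finset.compl_empty] at h
    exact h (reconstructibleOn_univ x)

theorem depth_lt : ∀ (n : ℕ) (x : Hole n), depth n x < n
  | 0, x => x.elim
  | _ + 1, none => Nat.succ_pos _
  | n + 1, some (_, y) => Nat.succ_lt_succ (depth_lt n y)

end SierpinskiCode

end

theorem mainTheorem4 (n : ℕ) (x : SierpinskiCode.Hole n) :
    IsLeast (SierpinskiCode.uncorrectableSizes n x) (SierpinskiCode.connectedDistance n x) ∧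
    (SierpinskiCode.depth n x + 2 ≤ n →
      (SierpinskiCode.connectedDistance n x : ℚ) =
        (Fintype.card (SierpinskiCode.Site n) : ℚ) / 3 ^ (SierpinskiCode.depth n x + 2) + 1) ∧
    (SierpinskiCode.depth n x + 1 = n → SierpinskiCode.connectedDistance n x = 1) ∧
    (∀ y : SierpinskiCode.Hole n, SierpinskiCode.depth n x < SierpinskiCode.depth n y →
      SierpinskiCode.connectedDistance n y < SierpinskiCode.connectedDistance n x) := by
  open SierpinskiCode in
  have h1 (x : Hole n) (hx : depth n x + 1 = n) : connectedDistance n x = 1 :=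
    (isLeast_uncorrectableSizes_one x hx).csInf_eq
  have h2 (x : Hole n) (k : ℕ) (hx : depth n x + (k + 2) = n) :
      connectedDistance n x = 3 ^ k + 1 := (isLeast_uncorrectableSizes x hx).csInf_eq
  have hcases (x : Hole n) : depth n x + 1 = n ∨ ∃ k, depth n x + (k + 2) = n := by
    rcases Nat.lt_or_ge (depth n x + 1) n with h | h
    · exact .inr ⟨n - depth n x - 2, by omega⟩
    · exact .inl (le_antisymm (depth_lt n x) h)
  refine ⟨?_, fun hx => ?_, h1 x, fun y hy => ?_⟩
  · rcases hcases x with hx | ⟨k, hx⟩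
    · rw [h1 x hx]; exact isLeast_uncorrectableSizes_one x hx
    · rw [h2 x k hx]; exact isLeast_uncorrectableSizes x hx
  · obtain ⟨k, hk⟩ := Nat.exists_eq_add_of_le hx
    rw [h2 x k (by omega), card_site]
    have : (3 : ℚ) ^ n = 3 ^ k * 3 ^ (depth n x + 2) := by rw [← pow_add]; congr 1; omega
    push_cast
    rw [this, mul_div_cancel_right₀ _ (by positivity)]
  · have hlt := depth_lt n y
    obtain ⟨k, hk⟩ : ∃ k, depth n x + (k + 2) = n := ⟨n - depth n x - 2, by omega⟩
    rw [h2 x k hk]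
    rcases hcases y with hy' | ⟨l, hl⟩
    · rw [h1 y hy']
      have : 0 < 3 ^ k := by positivity
      omega
    · rw [h2 y l hl]
      have : 3 ^ l < 3 ^ k := Nat.pow_lt_pow_right (by norm_num) (by omega)
      omega
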